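/- Let $k$ be a positive integer or $k=\infty$. A real normed space $X$ is said to admit $C^k$ partitions of unity if for every covering $\mathcal V$ of $X$ by open sets there is a locally finite partition of unity $(\varphi_i)_{i\in I}$ on $X$ (so each $\varphi_i\ge 0$, every point of $X$ has a neighbourhood on which all but finitely many $\varphi_i$ vanish, and $\sum_{i\in I}\varphi_i=1$ on $X$) consisting of functions $\varphi_i:X\to\mathbb R$ of class $C^k$ in the Fréchet sense and subordinate to $\mathcal V$, that is, the closed support of each $\varphi_i$ is contained in some member of $\mathcal V$. Let $\Omega$ be an ordinal and let $E$ be a real Banach space admitting $C^k$ partitions of unity. Then the Banach space $C([0,\Omega];E)$ of continuous functions from $[0,\Omega]$ (the set of ordinals $\alpha\le\Omega$ with the order topology) to $E$, with the supremum norm, also admits $C^k$ partitions of unity. -/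

import Mathlib

universe u v

/-- A real normed space `X` admits partitions of unity of class `C^k`: for every covering `𝒱` of
`X` by open sets there is a (locally finite, continuous) partition of unity on `X` that consists of
functions of class `C^k` in the Fréchet sense and is subordinate to `𝒱`, i.e. the closed support of
each of its members is contained in some member of `𝒱`.
Here `k : ℕ∞`, so `k` is a natural number or `∞` (infinitely differentiable). -/
def AdmitsPartitionsOfUnity (k : ℕ∞) (X : Type u) [NormedAddCommGroup X] [NormedSpace ℝ X] :
    Prop :=
  ∀ 𝒱 : Set (Set X), (∀ V ∈ 𝒱, IsOpen V) → ⋃₀ 𝒱 = Set.univ →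
    ∃ (ι : Type u) (f : PartitionOfUnity ι X Set.univ),
      (∀ i, ContDiff ℝ k (f i)) ∧ ∀ i, ∃ V ∈ 𝒱, tsupport (f i) ⊆ V

/-! A function `x` on a compact well-ordered space `K` is encoded by its jumps `x (α + 1) - x α`.
They tend to `0`, so a function on `E` that vanishes near `0` sees only finitely many of them,
uniformly near `x`; this is the source of all local finiteness. On the other hand the jumps detect
enough: the last point at which `‖x‖` is at least `ε` is a jump of `x`. This gives `C^k` bump
functions on `C(K, E)`, and, adding one point at a time from the right, it shows that `x` is
uniformly close to a step function with steps at finitely many of its jumps.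

At a fixed scale, the functions which prescribe a finite set of jump points, the approximate values
of `x` at these points and the closeness of `x` to its step function form countably many locally
finite families, whose members have small supports. Such a σ-locally finite family refines to a
partition of unity. -/

open Set Function Filter Topology Metric
open scoped Manifold

section LocallyFinite

variable {X ι : Type*} [TopologicalSpace X]

theorem locallyFinite_sigma_inter {κ : ι → Type*} {A : ι → Set X} {B : ∀ i, κ i → Set X}
    (hA : LocallyFinite A) (hB : ∀ i, LocallyFinite (B i)) :
    LocallyFinite fun p : Σ i, κ i => A p.1 ∩ B p.1 p.2 := by
  intro x
  obtain ⟨t, ht, htfin⟩ := hA x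
  choose s hs hsfin using fun i => hB i x
  refine ⟨t ∩ ⋂ i ∈ htfin.toFinset, s i,
    inter_mem ht ((biInter_finset_mem _).2 fun i _ => hs i),
    (htfin.toFinset.finite_toSet.biUnion fun i _ => (hsfin i).image (Sigma.mk i)).subset ?_⟩
  rintro ⟨i, j⟩ ⟨y, ⟨hyA, hyB⟩, hyt, hys⟩
  have hi : i ∈ htfin.toFinset := htfin.mem_toFinset.2 ⟨y, hyA, hyt⟩
  exact mem_biUnion hi ⟨j, ⟨y, hyB, mem_iInter₂.1 hys i hi⟩, rfl⟩

theorem locallyFinite_biInter_finset {A : ι → Set X} (hA : LocallyFinite A) :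
    LocallyFinite fun s : Finset ι => ⋂ i ∈ s, A i := by
  intro x
  obtain ⟨t, ht, htfin⟩ := hA x
  refine ⟨t, ht, htfin.toFinset.powerset.finite_toSet.subset ?_⟩
  rintro s ⟨y, hys, hyt⟩
  exact Finset.mem_coe.2 <| Finset.mem_powerset.2 fun i hi =>
    htfin.mem_toFinset.2 ⟨y, mem_iInter₂.1 hys i hi, hyt⟩

theorem locallyFinite_setOf_lt {α : Type*} [LinearOrder α] [TopologicalSpace α]
    [OrderClosedTopology α] {f : X → α} (hf : Continuous f) {c : ℕ → α} (hc : Monotone c)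
    (hfc : ∀ x, ∃ n, f x < c n) : LocallyFinite fun n => {x | c n < f x} := by
  intro x
  obtain ⟨N, hN⟩ := hfc x
  refine ⟨{y | f y < c N}, (isOpen_lt hf continuous_const).mem_nhds hN,
    (finite_Iio N).subset ?_⟩
  rintro n ⟨y, hny, hyN⟩
  exact hc.reflect_lt (lt_trans hny hyN)

theorem finsum_pos_of_locallyFinite {f : ι → X → ℝ} (hlf : LocallyFinite fun i => support (f i))
    (hf : ∀ i x, 0 ≤ f i x) {x : X} (hx : ∃ i, f i x ≠ 0) : 0 < ∑ᶠ i, f i x :=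
  finsum_pos (fun i => hf i x) (hx.imp fun i hi => (hf i x).lt_of_ne' hi) (hlf.point_finite x)

end LocallyFinite

section ContDiff

variable {X : Type*} [NormedAddCommGroup X] [NormedSpace ℝ X]

theorem contDiff_finsum {n : WithTop ℕ∞} {ι F : Type*} [NormedAddCommGroup F] [NormedSpace ℝ F]
    {f : ι → X → F} (hlf : LocallyFinite fun i => support (f i))
    (hf : ∀ i, ContDiff ℝ n (f i)) : ContDiff ℝ n fun x => ∑ᶠ i, f i x :=
  (contMDiff_finsum (fun i => (hf i).contMDiff) hlf).contDiff

variable {k : ℕ∞}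

theorem exists_contDiff_support_subset {ι : Type*} {O : TopologicalSpace.Opens X} {u : ι → X → ℝ}
    (hu : ∀ i, ContDiff ℝ k (u i)) (hu_nonneg : ∀ i x, 0 ≤ u i x)
    (hlf : LocallyFinite fun i => support fun x : O => u i x)
    (hout : ∀ x ∉ O, ∃ i, u i =ᶠ[𝓝 x] 1) :
    ∃ φ : X → ℝ, ContDiff ℝ k φ ∧ (∀ x, 0 ≤ φ x) ∧ support φ ⊆ O ∧
      ∀ x ∈ O, (∀ i, u i x = 0) → φ x = 1 := by
  let φ : X → ℝ := (O : Set X).indicator fun x => Real.smoothTransition (1 - ∑ᶠ i, u i x)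
  refine ⟨φ, contDiff_iff_contDiffAt.2 fun x => ?_,
    indicator_nonneg fun x _ => Real.smoothTransition.nonneg _, support_indicator_subset,
    fun x hxO hx => by simp [φ, hxO, hx]⟩
  by_cases hxO : x ∈ O
  · have hsum : ContDiffAt ℝ k (fun y => ∑ᶠ i, u i y) x :=
      (contMDiffAt_subtype_iff (x := (⟨x, hxO⟩ : O)).1 <| contMDiffAt_finsum hlf fun i =>
        contMDiffAt_subtype_iff.2 (hu i).contMDiff.contMDiffAt).contDiffAt
    have hcomp : ContDiffAt ℝ k (fun y => Real.smoothTransition (1 - ∑ᶠ i, u i y)) x :=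
      Real.smoothTransition.contDiffAt.comp x (contDiffAt_const.sub hsum)
    refine hcomp.congr_of_eventuallyEq ?_
    filter_upwards [O.isOpen.mem_nhds hxO] with y hy using indicator_of_mem hy _
  · obtain ⟨i, hi⟩ := hout x hxO
    refine (contDiffAt_const (c := (0 : ℝ))).congr_of_eventuallyEq ?_
    filter_upwards [hi] with y hy
    refine indicator_apply_eq_zero.2 fun hyO => Real.smoothTransition.zero_of_nonpos ?_
    have hle : u i y ≤ ∑ᶠ j, u j y :=
      single_le_finsum i (hlf.point_finite ⟨y, hyO⟩) fun j => hu_nonneg j y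
    rw [hy, Pi.one_apply] at hle
    linarith

theorem exists_locallyFinite_disjointing {g : ℕ → X → ℝ} (hg : ∀ n, ContDiff ℝ k (g n))
    (hg_nonneg : ∀ n x, 0 ≤ g n x) (hg_cover : ∀ x, ∃ n, g n x ≠ 0) :
    ∃ h : ℕ → X → ℝ, (∀ n, ContDiff ℝ k (h n)) ∧ (∀ n x, 0 ≤ h n x) ∧
      (LocallyFinite fun n => support (h n)) ∧ ∀ x, ∃ n, g n x ≠ 0 ∧ h n x ≠ 0 := by
  refine ⟨fun n x => ∏ m ∈ Finset.range n, Real.smoothTransition (1 - (n + 1) * g m x),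
    fun n => contDiff_prod fun m _ => Real.smoothTransition.contDiff.comp
      (contDiff_const.sub (contDiff_const.mul (hg m))),
    fun n x => Finset.prod_nonneg fun m _ => Real.smoothTransition.nonneg _,
    fun x => ?_, fun x => ?_⟩
  · obtain ⟨m, hm⟩ := hg_cover x
    have hpos : 0 < g m x := (hg_nonneg m x).lt_of_ne' hm
    obtain ⟨N, hN⟩ := exists_nat_one_div_lt hpos
    refine ⟨{y | 1 / ((N : ℝ) + 1) < g m y},
      (isOpen_lt continuous_const (hg m).continuous).mem_nhds hN,
      (finite_Iio (max N (m + 1))).subset ?_⟩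
    rintro n ⟨y, hy, hNy⟩
    by_contra hn
    obtain ⟨hNn, hmn⟩ := max_le_iff.1 (not_lt.1 (mem_Iio.not.1 hn))
    refine hy (Finset.prod_eq_zero (Finset.mem_range.2 hmn)
      (Real.smoothTransition.zero_of_nonpos ?_))
    have hy_large : 1 / ((n : ℝ) + 1) < g m y :=
      (Nat.one_div_le_one_div hNn).trans_lt hNy
    rw [div_lt_iff₀' (by positivity)] at hy_large
    linarith
  · classical
    refine ⟨Nat.find (hg_cover x), Nat.find_spec (hg_cover x),
      Finset.prod_ne_zero_iff.2 fun m hm => ?_⟩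
    have hmx : g m x = 0 := not_not.1 (Nat.find_min (hg_cover x) (Finset.mem_range.1 hm))
    simp [hmx]

theorem exists_partitionOfUnity_of_locallyFinite {ι : Type*} {f : ι → X → ℝ}
    (hf : ∀ i, ContDiff ℝ k (f i)) (hf_nonneg : ∀ i x, 0 ≤ f i x)
    (hlf : LocallyFinite fun i => support (f i)) (hf_cover : ∀ x, ∃ i, f i x ≠ 0) :
    ∃ F : PartitionOfUnity ι X univ, (∀ i, ContDiff ℝ k (F i)) ∧
      ∀ i, support (F i) = support (f i) := by
  have hpos : ∀ x, 0 < ∑ᶠ i, f i x := fun x =>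
    finsum_pos_of_locallyFinite hlf hf_nonneg (hf_cover x)
  have hF : ∀ i, ContDiff ℝ k fun x => f i x / ∑ᶠ j, f j x := fun i =>
    (hf i).div (contDiff_finsum hlf hf) fun x => (hpos x).ne'
  have hsupp : ∀ i, (support fun x => f i x / ∑ᶠ j, f j x) = support (f i) := fun i => by
    ext x
    simp [(hpos x).ne']
  have hsum : ∀ x, ∑ᶠ i, f i x / ∑ᶠ j, f j x = 1 := fun x => by
    simp_rw [div_eq_mul_inv]
    rw [← finsum_mul' _ _ (hlf.point_finite x), mul_inv_cancel₀ (hpos x).ne']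
  exact ⟨{ toFun := fun i => ⟨fun x => f i x / ∑ᶠ j, f j x, (hF i).continuous⟩
           locallyFinite' := hlf.subset fun i => (hsupp i).subset
           nonneg' := fun i x => div_nonneg (hf_nonneg i x) (hpos x).le
           sum_eq_one' := fun x _ => hsum x
           sum_le_one' := fun x => (hsum x).le }, hF, hsupp⟩

theorem exists_partitionOfUnity_of_sigmaLocallyFinite {ι : ℕ → Type*} {f : ∀ n, ι n → X → ℝ}
    (hf : ∀ n i, ContDiff ℝ k (f n i)) (hf_nonneg : ∀ n i x, 0 ≤ f n i x)
    (hlf : ∀ n, LocallyFinite fun i => support (f n i)) (hf_cover : ∀ x, ∃ n i, f n i x ≠ 0) :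
    ∃ F : PartitionOfUnity (Σ n, ι n) X univ, (∀ p, ContDiff ℝ k (F p)) ∧
      ∀ p, support (F p) ⊆ support (f p.1 p.2) := by
  obtain ⟨h, hh, hh_nonneg, hhlf, hh_cover⟩ := exists_locallyFinite_disjointing
    (fun n => contDiff_finsum (hlf n) (hf n)) (fun n x => finsum_nonneg fun i => hf_nonneg n i x)
    fun x => (hf_cover x).imp fun n hn =>
      (finsum_pos_of_locallyFinite (hlf n) (hf_nonneg n) hn).ne'
  obtain ⟨F, hF, hFsupp⟩ := exists_partitionOfUnity_of_locallyFinite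
    (f := fun (p : Σ n, ι n) x => h p.1 x * f p.1 p.2 x) (fun p => (hh p.1).mul (hf p.1 p.2))
    (fun p x => mul_nonneg (hh_nonneg p.1 x) (hf_nonneg p.1 p.2 x))
    (by simpa only [support_mul] using locallyFinite_sigma_inter hhlf hlf) fun x => by
      obtain ⟨n, hfn, hhn⟩ := hh_cover x
      by_contra! hzero
      exact hfn (finsum_eq_zero_of_forall_eq_zero fun i =>
        (mul_eq_zero.1 (hzero ⟨n, i⟩)).resolve_left hhn)
  exact ⟨F, hF, fun p => (hFsupp p).trans_subset (support_mul_subset_right _ _)⟩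

end ContDiff

section AdmitsPartitionsOfUnity

variable {X : Type u} [NormedAddCommGroup X] [NormedSpace ℝ X] {k : ℕ∞}

theorem admitsPartitionsOfUnity_iff_support_subset_closedBall :
    AdmitsPartitionsOfUnity k X ↔ ∀ r > 0, ∃ (ι : Type u) (f : PartitionOfUnity ι X univ),
      (∀ i, ContDiff ℝ k (f i)) ∧ ∀ i, ∀ x ∈ support (f i), support (f i) ⊆ closedBall x r := by
  refine ⟨fun hX r hr => ?_, fun hX 𝒱 hopen hcover => ?_⟩
  · obtain ⟨ι, f, hf, hsub⟩ := hX (range fun c => ball c (r / 2))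
      (forall_mem_range.2 fun c => isOpen_ball)
      (eq_univ_of_forall fun x => ⟨_, mem_range_self x, mem_ball_self (half_pos hr)⟩)
    refine ⟨ι, f, hf, fun i x hx y hy => ?_⟩
    obtain ⟨_, ⟨c, rfl⟩, hc⟩ := hsub i
    have hxc : dist x c < r / 2 := hc (subset_tsupport _ hx)
    have hyc : dist y c < r / 2 := hc (subset_tsupport _ hy)
    rw [mem_closedBall]
    linarith [dist_triangle_right y x c]
  · choose ι f hf hball using fun n : ℕ => hX (1 / ((n : ℝ) + 1)) Nat.one_div_pos_of_nat
    obtain ⟨F, hF, hsupp⟩ := exists_partitionOfUnity_of_sigmaLocallyFinite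
      (f := fun n (i : {i : ι n // ∃ V ∈ 𝒱, tsupport (f n i) ⊆ V}) => f n i)
      (fun n i => hf n i) (fun n i => (f n).nonneg i)
      (fun n => (f n).locallyFinite.comp_injective Subtype.coe_injective) fun x => by
        obtain ⟨V, hV, hxV⟩ := mem_sUnion.1 (hcover ▸ mem_univ x)
        obtain ⟨r, hr, hrV⟩ := Metric.isOpen_iff.1 (hopen V hV) x hxV
        obtain ⟨n, hn⟩ := exists_nat_one_div_lt hr
        obtain ⟨i, hi⟩ := (f n).exists_pos (mem_univ x)
        have hiV : tsupport (f n i) ⊆ V :=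
          (closure_minimal (hball n i x hi.ne') isClosed_closedBall).trans
            ((closedBall_subset_ball hn).trans hrV)
        exact ⟨n, ⟨i, V, hV, hiV⟩, hi.ne'⟩
    refine ⟨_, F, hF, fun p => ?_⟩
    obtain ⟨V, hV, hpV⟩ := p.2.2
    exact ⟨V, hV, (closure_mono (hsupp p)).trans hpV⟩

namespace AdmitsPartitionsOfUnity

theorem exists_contDiff_eqOn_zero_eqOn_one (hX : AdmitsPartitionsOfUnity k X) {A B : Set X}
    (hA : IsClosed A) (hB : IsClosed B) (hAB : Disjoint A B) :
    ∃ ψ : X → ℝ, ContDiff ℝ k ψ ∧ (∀ x, 0 ≤ ψ x) ∧ EqOn ψ 0 A ∧ EqOn ψ 1 B := by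
  obtain ⟨ι, f, hf, hsub⟩ := hX {Aᶜ, Bᶜ} (by simp [hA, hB])
    (by rw [sUnion_pair, ← compl_inter, hAB.inter_eq, compl_empty])
  let p : ι → Prop := fun i => tsupport (f i) ⊆ Aᶜ
  refine ⟨fun x => ∑ᶠ i : {i // p i}, f i x,
    contDiff_finsum (f.locallyFinite.comp_injective Subtype.coe_injective) fun i => hf i,
    fun x => finsum_nonneg fun i => f.nonneg i x,
    fun x hx => finsum_eq_zero_of_forall_eq_zero fun i => ?_, fun x hx => ?_⟩
  · exact notMem_support.1 fun hi => i.2 (subset_tsupport _ hi) hx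
  · have hp : ∀ i, f i x ≠ 0 → p i := fun i hi => by
      obtain ⟨V, rfl | rfl, hV⟩ := hsub i
      · exact hV
      · exact absurd hx (hV (subset_tsupport _ hi))
    rw [Pi.one_apply, ← f.sum_eq_one (mem_univ x)]
    refine (finsum_subtype_eq_finsum_cond (f := fun i => f i x) p).trans (finsum_congr fun i => ?_)
    by_cases hi : p i
    · simp only [hi, finsum_true]
    · simp only [hi, finsum_false, not_not.1 (mt (hp i) hi)]

theorem exists_contDiff_eq_zero_eq_one_of_norm (hX : AdmitsPartitionsOfUnity k X) {a b : ℝ}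
    (hab : a < b) : ∃ ψ : X → ℝ, ContDiff ℝ k ψ ∧ (∀ x, 0 ≤ ψ x) ∧ (∀ x, ‖x‖ ≤ a → ψ x = 0) ∧
      ∀ x, b ≤ ‖x‖ → ψ x = 1 :=
  hX.exists_contDiff_eqOn_zero_eqOn_one (isClosed_le continuous_norm continuous_const)
    (isClosed_le continuous_const continuous_norm)
    (disjoint_left.2 fun _ hxa hxb => hab.not_ge (le_trans hxb hxa))

theorem exists_seq_eventuallyEq_one (hX : AdmitsPartitionsOfUnity k X) :
    ∃ ψ : ℕ → X → ℝ, (∀ n, ContDiff ℝ k (ψ n)) ∧ (∀ n x, 0 ≤ ψ n x) ∧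
      (∀ n, ψ n =ᶠ[𝓝 0] 0) ∧ ∀ x ≠ 0, ∀ᶠ n in atTop, ψ n =ᶠ[𝓝 x] 1 := by
  obtain ⟨c, hc, hc_pos, hc_lim⟩ := exists_seq_strictAnti_tendsto (0 : ℝ)
  choose ψ hψ hψ_nonneg hψ_zero hψ_one using fun n : ℕ =>
    hX.exists_contDiff_eq_zero_eq_one_of_norm (hc n.lt_succ_self)
  refine ⟨ψ, hψ, hψ_nonneg, fun n => ?_, fun x hx => ?_⟩
  · filter_upwards [closedBall_mem_nhds (0 : X) (hc_pos (n + 1))] with x hx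
    exact hψ_zero n x (mem_closedBall_zero_iff.1 hx)
  · filter_upwards [hc_lim.eventually_lt_const (norm_pos_iff.2 hx)] with n hn
    filter_upwards [(isOpen_lt continuous_const continuous_norm).mem_nhds hn] with y hy
    exact hψ_one n y (le_of_lt hy)

end AdmitsPartitionsOfUnity

end AdmitsPartitionsOfUnity

section Jump

variable {K : Type*} [TopologicalSpace K] [LinearOrder K] [SuccOrder K]

theorem isOpen_Iic_of_succOrder [OrderTopology K] (α : K) : IsOpen (Iic α) := by
  by_cases hα : IsMax α
  · rw [eq_univ_of_forall (s := Iic α) fun β => hα.isTop β]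
    exact isOpen_univ
  · rw [← Order.Iio_succ_of_not_isMax hα]
    exact isOpen_Iio

variable {E : Type*} [NormedAddCommGroup E] [NormedSpace ℝ E]

open Classical in
/-- The jump of `x` between `α` and its successor, where `x` is thought of as extended by `0`
past the greatest element of `K`. The jumps of `x` form a null family, which plays the role of an
operator into `c₀`. -/
noncomputable def jump (α : K) : C(K, E) →L[ℝ] E :=
  if IsMax α then -ContinuousMap.evalCLM ℝ α
  else ContinuousMap.evalCLM ℝ (Order.succ α) - ContinuousMap.evalCLM ℝ α

theorem jump_of_isMax {α : K} (hα : IsMax α) (x : C(K, E)) : jump α x = -x α := by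
  simp [jump, hα]

theorem jump_of_not_isMax {α : K} (hα : ¬IsMax α) (x : C(K, E)) :
    jump α x = x (Order.succ α) - x α := by
  simp [jump, hα]

theorem norm_jump_le [CompactSpace K] (α : K) (x : C(K, E)) : ‖jump α x‖ ≤ 2 * ‖x‖ := by
  have hxα := x.norm_coe_le_norm α
  by_cases hα : IsMax α
  · rw [jump_of_isMax hα, norm_neg]
    linarith [norm_nonneg x]
  · rw [jump_of_not_isMax hα]
    linarith [norm_sub_le (x (Order.succ α)) (x α), x.norm_coe_le_norm (Order.succ α)]

variable [OrderTopology K]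

theorem tendsto_jump_nhdsNE (x : C(K, E)) (l : K) :
    Tendsto (fun α => jump α x) (𝓝[≠] l) (𝓝 0) := by
  have hlt : ∀ᶠ α in 𝓝[≠] l, α < l := by
    filter_upwards [self_mem_nhdsWithin,
      mem_nhdsWithin_of_mem_nhds ((isOpen_Iic_of_succOrder l).mem_nhds self_mem_Iic)]
      with α hne hle using lt_of_le_of_ne hle hne
  have hid : Tendsto id (𝓝[≠] l) (𝓝 l) := nhdsWithin_le_nhds
  have hsucc : Tendsto Order.succ (𝓝[≠] l) (𝓝 l) :=
    tendsto_of_tendsto_of_tendsto_of_le_of_le' hid tendsto_const_nhds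
      (.of_forall Order.le_succ) (hlt.mono fun α => Order.succ_le_of_lt)
  have hsub := ((x.continuous.tendsto l).comp hsucc).sub ((x.continuous.tendsto l).comp hid)
  rw [sub_self] at hsub
  exact hsub.congr' (hlt.mono fun α hα => (jump_of_not_isMax hα.not_isMax x).symm)

variable [CompactSpace K]

theorem tendsto_jump_cofinite (x : C(K, E)) :
    Tendsto (fun α => jump α x) cofinite (𝓝 0) := by
  refine Tendsto.mono_left (fun U hU => mem_codiscrete.2 fun l => ?_) cofinite_le_codiscrete
  rw [disjoint_principal_right, compl_compl]
  exact tendsto_jump_nhdsNE x l hU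

theorem locallyFinite_support_comp_jump {M : Type*} [Zero M] {ψ : E → M} (hψ : ψ =ᶠ[𝓝 0] 0) :
    LocallyFinite fun α : K => support fun x : C(K, E) => ψ (jump α x) := by
  obtain ⟨a, ha, hψa⟩ := Metric.eventually_nhds_iff_ball.1 hψ
  intro x
  have hfin : {α | ¬‖jump α x‖ < a / 2}.Finite := by
    simpa using (tendsto_jump_cofinite x).norm.eventually_lt_const
      (by simpa using half_pos ha : ‖(0 : E)‖ < a / 2)
  refine ⟨ball x (a / 4), ball_mem_nhds x (by positivity), hfin.subset ?_⟩
  rintro α ⟨y, hy, hyx⟩ hα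
  refine hy (hψa _ (mem_ball_zero_iff.2 ?_))
  have hdiff := norm_jump_le α (y - x)
  rw [mem_ball, dist_eq_norm] at hyx
  rw [map_sub] at hdiff
  linarith [norm_le_norm_add_norm_sub' (jump α y) (jump α x)]

theorem exists_last_norm_ge {x : C(K, E)} {ε : ℝ} (hε : 0 < ε) (hx : ε ≤ ‖x‖) :
    ∃ β, ε ≤ ‖x β‖ ∧ jump β x ≠ 0 ∧ ∀ γ, β < γ → ‖x γ‖ < ε := by
  have hne : {β | ε ≤ ‖x β‖}.Nonempty := by
    by_contra! hempty
    refine hx.not_gt ((x.norm_lt_iff hε).2 fun β => lt_of_not_ge fun hβ => ?_)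
    exact hempty.subset hβ
  have hclosed : IsClosed {β | ε ≤ ‖x β‖} := isClosed_le continuous_const x.continuous.norm
  obtain ⟨β, hβ : ε ≤ ‖x β‖, hmax⟩ := hclosed.isCompact.exists_isGreatest hne
  have hlast : ∀ γ, β < γ → ‖x γ‖ < ε := fun γ hγ => lt_of_not_ge fun hle => (hmax hle).not_gt hγ
  refine ⟨β, hβ, fun hjump => ?_, hlast⟩
  by_cases hβmax : IsMax β
  · rw [jump_of_isMax hβmax, neg_eq_zero] at hjump
    rw [hjump, norm_zero] at hβ
    exact hβ.not_gt hε
  · rw [jump_of_not_isMax hβmax, sub_eq_zero] at hjump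
    exact (hlast _ (Order.lt_succ_of_not_isMax hβmax)).not_ge (hjump ▸ hβ)

end Jump

section StepProj

variable {K : Type*} [LinearOrder K] {E : Type*} [NormedAddCommGroup E] [NormedSpace ℝ E]

/-- Evaluation at the least element of a finite set; the evaluation at the empty set is `0`. It is
used to describe the values of a step function with finitely many steps. -/
noncomputable def evalMin (s : Finset K) : (K → E) →ₗ[ℝ] E :=
  if hs : s.Nonempty then LinearMap.proj (s.min' hs) else 0

theorem evalMin_of_isLeast {s : Finset K} {α : K} (hα : IsLeast (s : Set K) α) (x : K → E) :
    evalMin s x = x α := by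
  have hs : s.Nonempty := ⟨α, hα.1⟩
  rw [evalMin, dif_pos hs, LinearMap.proj_apply, (s.isLeast_min' hs).unique hα]

theorem norm_evalMin_le {s : Finset K} {x : K → E} {δ : ℝ} (hδ : 0 ≤ δ)
    (hx : ∀ α ∈ s, ‖x α‖ ≤ δ) : ‖evalMin s x‖ ≤ δ := by
  by_cases hs : s.Nonempty
  · rw [evalMin, dif_pos hs]
    exact hx _ (s.min'_mem hs)
  · rwa [evalMin, dif_neg hs, LinearMap.zero_apply, norm_zero]

variable [TopologicalSpace K] [OrderTopology K] [SuccOrder K]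

theorem isLocallyConstant_filter_le (F : Finset K) :
    IsLocallyConstant fun β => F.filter (β ≤ ·) := by
  refine (IsLocallyConstant.iff_eventually_eq _).2 fun γ => ?_
  have hiff : ∀ α ∈ F, ∀ᶠ β in 𝓝 γ, β ≤ α ↔ γ ≤ α := fun α _ => by
    rcases le_or_gt γ α with hγ | hγ
    · filter_upwards [(isOpen_Iic_of_succOrder α).mem_nhds hγ] with β hβ using iff_of_true hβ hγ
    · filter_upwards [Ioi_mem_nhds hγ] with β hβ using iff_of_false hβ.not_ge hγ.not_ge
  filter_upwards [(Finset.eventually_all F).2 hiff] with β hβ using Finset.filter_congr hβ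

variable [CompactSpace K]

/-- The projection of `C(K, E)` onto the step functions with steps at `F`: `stepProj F x` agrees
with `x` on `F`, is constant on `(α, β]` for consecutive `α`, `β` in `F`, and vanishes past `F`. -/
noncomputable def stepProj (F : Finset K) : C(K, E) →L[ℝ] C(K, E) :=
  LinearMap.mkContinuous
    { toFun := fun x => ⟨fun β => evalMin (F.filter (β ≤ ·)) x,
        ((isLocallyConstant_filter_le F).comp fun s => evalMin s x).continuous⟩
      map_add' := fun x y => ContinuousMap.ext fun _ => (evalMin _).map_add (x : K → E) y
      map_smul' := fun c x =>
        ContinuousMap.ext fun _ => (evalMin _).map_smul c (x : K → E) }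
    1 fun x => by
      rw [one_mul, ContinuousMap.norm_le _ (norm_nonneg x)]
      exact fun β => norm_evalMin_le (norm_nonneg x) fun α _ => x.norm_coe_le_norm α

theorem stepProj_apply (F : Finset K) (x : C(K, E)) (β : K) :
    stepProj F x β = evalMin (F.filter (β ≤ ·)) x :=
  rfl

theorem stepProj_apply_of_mem {F : Finset K} {β : K} (hβ : β ∈ F) (x : C(K, E)) :
    stepProj F x β = x β :=
  evalMin_of_isLeast ⟨by simp [hβ], fun α hα => (Finset.mem_filter.1 hα).2⟩ x

theorem stepProj_insert_apply_of_lt (F : Finset K) {β γ : K} (hγ : β < γ) (x : C(K, E)) :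
    stepProj (insert β F) x γ = stepProj F x γ := by
  rw [stepProj_apply, stepProj_apply, Finset.filter_insert, if_neg hγ.not_ge]

theorem jump_stepProj_of_notMem {F : Finset K} {β : K} (hβ : β ∉ F) (x : C(K, E)) :
    jump β (stepProj F x) = 0 := by
  have hne : ∀ α ∈ F, α ≠ β := fun α hα => ne_of_mem_of_not_mem hα hβ
  by_cases hmax : IsMax β
  · have hempty : F.filter (β ≤ ·) = ∅ :=
      Finset.filter_eq_empty_iff.2 fun α hα hle => hne α hα (hmax.eq_of_ge hle)
    rw [jump_of_isMax hmax, stepProj_apply, hempty, evalMin, dif_neg Finset.not_nonempty_empty,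
      LinearMap.zero_apply, neg_zero]
  · have hfilter : F.filter (Order.succ β ≤ ·) = F.filter (β ≤ ·) :=
      Finset.filter_congr fun α hα => by
        rw [Order.succ_le_iff_of_not_isMax hmax, lt_iff_le_and_ne, and_iff_left (hne α hα).symm]
    rw [jump_of_not_isMax hmax, stepProj_apply, stepProj_apply, hfilter, sub_self]

theorem norm_stepProj_le {F : Finset K} {x : C(K, E)} {δ : ℝ} (hδ : 0 ≤ δ)
    (hx : ∀ α ∈ F, ‖x α‖ ≤ δ) : ‖stepProj F x‖ ≤ δ :=
  (ContinuousMap.norm_le _ hδ).2 fun _ =>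
    norm_evalMin_le hδ fun α hα => hx α (Finset.mem_filter.1 hα).1

theorem dist_le_of_norm_sub_stepProj_le {F : Finset K} {x y : C(K, E)} {ε δ : ℝ} (hδ : 0 ≤ δ)
    (hx : ‖x - stepProj F x‖ ≤ ε) (hy : ‖y - stepProj F y‖ ≤ ε)
    (hxy : ∀ α ∈ F, dist (x α) (y α) ≤ δ) : dist x y ≤ 2 * ε + δ := by
  have hF : dist (stepProj F x) (stepProj F y) ≤ δ := by
    rw [dist_eq_norm, ← map_sub]
    exact norm_stepProj_le hδ fun α hα => by simpa [dist_eq_norm] using hxy α hα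
  rw [← dist_eq_norm] at hx hy
  linarith [dist_triangle4_right x y (stepProj F x) (stepProj F y)]

/-- Points are added from the right: each new point is the last one at which the error is at least
`ε`, and well-foundedness stops the process. -/
theorem exists_finset_norm_sub_stepProj_lt [WellFoundedLT K] (x : C(K, E)) {ε : ℝ} (hε : 0 < ε) :
    ∃ F : Finset K, (∀ α ∈ F, jump α x ≠ 0) ∧ ‖x - stepProj F x‖ < ε := by
  by_contra! hlarge
  have hstep : ∀ F : Finset K, (∀ α ∈ F, jump α x ≠ 0) → ∃ β, ε ≤ ‖(x - stepProj F x) β‖ ∧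
      ∃ F' : Finset K, (∀ α ∈ F', jump α x ≠ 0) ∧ ∀ γ, β ≤ γ → ‖(x - stepProj F' x) γ‖ < ε := by
    intro F hF
    obtain ⟨β, hβ, hjump, hlast⟩ := exists_last_norm_ge hε (hlarge F hF)
    have hβF : β ∉ F := fun hmem => by
      rw [ContinuousMap.sub_apply, stepProj_apply_of_mem hmem, sub_self, norm_zero] at hβ
      exact hβ.not_gt hε
    rw [map_sub, jump_stepProj_of_notMem hβF, sub_zero] at hjump
    refine ⟨β, hβ, insert β F, (Finset.forall_mem_insert _ _ _).2 ⟨hjump, hF⟩, fun γ hγ => ?_⟩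
    rw [ContinuousMap.sub_apply]
    rcases hγ.eq_or_lt with rfl | hγ
    · rwa [stepProj_apply_of_mem (Finset.mem_insert_self _ _), sub_self, norm_zero]
    · rw [stepProj_insert_apply_of_lt F hγ]
      exact hlast γ hγ
  let S : Set K := {β | ∃ F : Finset K, (∀ α ∈ F, jump α x ≠ 0) ∧
    ∀ γ, β ≤ γ → ‖(x - stepProj F x) γ‖ < ε}
  have hS : S.Nonempty := by
    obtain ⟨β, -, hβ⟩ := hstep ∅ (by simp)
    exact ⟨β, hβ⟩
  obtain ⟨β, ⟨F, hF, hFβ⟩, hmin⟩ := wellFounded_lt.has_min S hS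
  obtain ⟨γ, hγ, hγS⟩ := hstep F hF
  exact hmin γ hγS (lt_of_not_ge fun hle => (hFβ γ hle).not_ge hγ)

end StepProj

section SpaceOfContinuousMaps

variable {K E : Type*} [TopologicalSpace K] [LinearOrder K] [OrderTopology K] [SuccOrder K]
  [CompactSpace K] [NormedAddCommGroup E] [NormedSpace ℝ E] {k : ℕ∞}

theorem exists_contDiff_support_subset_ball (hE : AdmitsPartitionsOfUnity k E) {ε : ℝ}
    (hε : 0 < ε) : ∃ φ : C(K, E) → ℝ, ContDiff ℝ k φ ∧ (∀ x, 0 ≤ φ x) ∧ support φ ⊆ ball 0 ε ∧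
      φ 0 = 1 := by
  obtain ⟨c, hc, hc_mem, hc_lim⟩ := exists_seq_strictMono_tendsto' hε
  choose ρ hρ hρ_nonneg hρ_zero hρ_one using fun j : ℕ =>
    hE.exists_contDiff_eq_zero_eq_one_of_norm (hc j.lt_succ_self)
  obtain ⟨ψ, hψ, hψ_nonneg, hψ_zero, hψ_one⟩ := hE.exists_seq_eventuallyEq_one
  let O : TopologicalSpace.Opens C(K, E) := ⟨ball 0 ε, isOpen_ball⟩
  let u : (Σ _ : ℕ, K) → C(K, E) → ℝ := fun p x => ρ p.1 (x p.2) * ψ p.1 (jump p.2 x)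
  have hu : ∀ p, ContDiff ℝ k (u p) := fun p =>
    ((hρ p.1).comp (ContinuousMap.evalCLM ℝ p.2).contDiff).mul
      ((hψ p.1).comp (jump p.2).contDiff)
  have hlf : LocallyFinite fun p => support fun x : O => u p x := by
    have hnorm : LocallyFinite fun j => {x : O | c j < ‖(x : C(K, E))‖} :=
      locallyFinite_setOf_lt continuous_subtype_val.norm hc.monotone fun x =>
        (hc_lim.eventually_const_lt (mem_ball_zero_iff.1 x.2)).exists
    refine (locallyFinite_sigma_inter hnorm fun j => (locallyFinite_support_comp_jump
      (hψ_zero j)).preimage_continuous continuous_subtype_val).subset fun p x hx => ?_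
    exact ⟨lt_of_not_ge fun hle => left_ne_zero_of_mul hx
      (hρ_zero p.1 _ ((x.1.norm_coe_le_norm p.2).trans hle)), right_ne_zero_of_mul hx⟩
  have hout : ∀ x ∉ O, ∃ p, u p =ᶠ[𝓝 x] 1 := fun x hx => by
    obtain ⟨β, hβ, hjump, -⟩ := exists_last_norm_ge hε (x := x)
      (not_lt.1 fun hlt => hx (mem_ball_zero_iff.2 hlt))
    obtain ⟨j, hj⟩ := (hψ_one _ hjump).exists
    have hβ_nhds : ∀ᶠ y in 𝓝 x, c (j + 1) < ‖y β‖ :=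
      (isOpen_lt continuous_const (ContinuousMap.evalCLM ℝ β).continuous.norm).mem_nhds
        ((hc_mem (j + 1)).2.trans_le hβ)
    refine ⟨⟨j, β⟩, ?_⟩
    filter_upwards [hβ_nhds, (jump β).continuous.continuousAt.eventually hj] with y hyβ hyψ
    exact (congrArg₂ _ (hρ_one j _ hyβ.le) hyψ).trans (one_mul 1)
  obtain ⟨φ, hφ, hφ_nonneg, hφO, hφ_one⟩ := exists_contDiff_support_subset hu
    (fun p x => mul_nonneg (hρ_nonneg _ _) (hψ_nonneg _ _)) hlf hout
  refine ⟨φ, hφ, hφ_nonneg, hφO, hφ_one 0 (mem_ball_self hε) fun p => ?_⟩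
  exact mul_eq_zero_of_left (hρ_zero p.1 _ (norm_zero.trans_le (hc_mem p.1).1.le)) _

variable {ι : Type*} {ψ : E → ℝ} {g : ι → E → ℝ} {φ : C(K, E) → ℝ}

/-- The members of the partitions of unity on `C(K, E)`, before normalization. For a finite set `s`
of pairs `⟨α, i⟩`, the function `stepPiece ψ g φ s` is nonzero at `x` when `x` jumps at each `α` (as
measured by `ψ`), `x α` lies in the support of `g i`, and `x` is close to its step function with
steps at the points `α` (as measured by `φ`). -/
noncomputable def stepPiece (ψ : E → ℝ) (g : ι → E → ℝ) (φ : C(K, E) → ℝ)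
    (s : Finset (Σ _ : K, ι)) (x : C(K, E)) : ℝ :=
  (∏ p ∈ s, ψ (jump p.1 x) * g p.2 (x p.1)) * φ (x - stepProj (s.image Sigma.fst) x)

theorem contDiff_stepPiece (hψ : ContDiff ℝ k ψ) (hg : ∀ i, ContDiff ℝ k (g i))
    (hφ : ContDiff ℝ k φ) (s : Finset (Σ _ : K, ι)) : ContDiff ℝ k (stepPiece ψ g φ s) :=
  (contDiff_prod fun p _ => (hψ.comp (jump p.1).contDiff).mul
    ((hg p.2).comp (ContinuousMap.evalCLM ℝ p.1).contDiff)).mul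
    (hφ.comp (ContinuousLinearMap.id ℝ C(K, E) - stepProj (s.image Sigma.fst)).contDiff)

theorem stepPiece_nonneg (hψ : ∀ v, 0 ≤ ψ v) (hg : ∀ i v, 0 ≤ g i v) (hφ : ∀ x, 0 ≤ φ x)
    (s : Finset (Σ _ : K, ι)) (x : C(K, E)) : 0 ≤ stepPiece ψ g φ s x :=
  mul_nonneg (Finset.prod_nonneg fun _ _ => mul_nonneg (hψ _) (hg _ _)) (hφ _)

theorem stepPiece_ne_zero_iff {s : Finset (Σ _ : K, ι)} {x : C(K, E)} :
    stepPiece ψ g φ s x ≠ 0 ↔ (∀ p ∈ s, ψ (jump p.1 x) ≠ 0 ∧ g p.2 (x p.1) ≠ 0) ∧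
      φ (x - stepProj (s.image Sigma.fst) x) ≠ 0 := by
  simp only [stepPiece, mul_ne_zero_iff, Finset.prod_ne_zero_iff]

theorem locallyFinite_support_stepPiece (hψ : ψ =ᶠ[𝓝 0] 0)
    (hg : LocallyFinite fun i => support (g i)) :
    LocallyFinite fun s => support (stepPiece ψ g φ s) := by
  have hpair : LocallyFinite fun p : Σ _ : K, ι =>
      (support fun x : C(K, E) => ψ (jump p.1 x)) ∩ {x | g p.2 (x p.1) ≠ 0} :=
    locallyFinite_sigma_inter (locallyFinite_support_comp_jump hψ) fun α =>
      hg.preimage_continuous (ContinuousMap.evalCLM ℝ α).continuous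
  exact (locallyFinite_biInter_finset hpair).subset fun s x hx =>
    mem_iInter₂.2 (stepPiece_ne_zero_iff.1 hx).1

theorem support_stepPiece_subset_closedBall {ε δ : ℝ} (hδ : 0 ≤ δ)
    (hg : ∀ i, ∀ v ∈ support (g i), support (g i) ⊆ closedBall v δ)
    (hφ : support φ ⊆ ball 0 ε) {s : Finset (Σ _ : K, ι)} {x : C(K, E)}
    (hx : x ∈ support (stepPiece ψ g φ s)) :
    support (stepPiece ψ g φ s) ⊆ closedBall x (2 * ε + δ) := by
  intro y hy
  obtain ⟨hxs, hxφ⟩ := stepPiece_ne_zero_iff.1 hx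
  obtain ⟨hys, hyφ⟩ := stepPiece_ne_zero_iff.1 hy
  refine dist_le_of_norm_sub_stepProj_le hδ (mem_ball_zero_iff.1 (hφ hyφ)).le
    (mem_ball_zero_iff.1 (hφ hxφ)).le (Finset.forall_mem_image.2 fun p hp => ?_)
  exact hg p.2 _ (hxs p hp).2 (hys p hp).2

theorem exists_stepPiece_ne_zero [WellFoundedLT K] {ψ : ℕ → E → ℝ}
    (hψ : ∀ v ≠ 0, ∀ᶠ n in atTop, ψ n v ≠ 0) (hg : ∀ v, ∃ i, g i v ≠ 0)
    (hφ : ∀ᶠ x in 𝓝 0, φ x ≠ 0) (x : C(K, E)) : ∃ n s, stepPiece (ψ n) g φ s x ≠ 0 := by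
  obtain ⟨δ, hδ, hφδ⟩ := Metric.eventually_nhds_iff_ball.1 hφ
  obtain ⟨F, hF, hFδ⟩ := exists_finset_norm_sub_stepProj_lt x hδ
  obtain ⟨n, hn⟩ := ((Finset.eventually_all F).2 fun α hα => hψ _ (hF α hα)).exists
  choose i hi using hg
  classical
  let s : Finset (Σ _ : K, ι) := F.image fun α => ⟨α, i (x α)⟩
  have hs : s.image Sigma.fst = F := by simp [s, Finset.image_image, Function.comp_def]
  refine ⟨n, s, stepPiece_ne_zero_iff.2 ⟨Finset.forall_mem_image.2 fun α hα => ⟨hn α hα, hi _⟩, ?_⟩⟩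
  rw [hs]
  exact hφδ _ (mem_ball_zero_iff.2 hFδ)

end SpaceOfContinuousMaps

theorem corollary5_general {k : ℕ∞} {K : Type u} [TopologicalSpace K] [LinearOrder K]
    [OrderTopology K] [CompactSpace K] [WellFoundedLT K] {E : Type v} [NormedAddCommGroup E]
    [NormedSpace ℝ E] (hE : AdmitsPartitionsOfUnity k E) : AdmitsPartitionsOfUnity k C(K, E) := by
  let : SuccOrder K := SuccOrder.ofLinearWellFoundedLT K
  refine admitsPartitionsOfUnity_iff_support_subset_closedBall.2 fun r hr => ?_
  obtain ⟨ι, g, hg, hg_ball⟩ :=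
    admitsPartitionsOfUnity_iff_support_subset_closedBall.1 hE (r / 3) (by positivity)
  obtain ⟨ψ, hψ, hψ_nonneg, hψ_zero, hψ_one⟩ := hE.exists_seq_eventuallyEq_one
  obtain ⟨φ, hφ, hφ_nonneg, hφ_ball, hφ_one⟩ :=
    exists_contDiff_support_subset_ball (K := K) hE (ε := r / 3) (by positivity)
  obtain ⟨f, hf, hf_supp⟩ := exists_partitionOfUnity_of_sigmaLocallyFinite
    (f := fun n (s : Finset (Σ _ : K, ι)) => stepPiece (ψ n) (fun i => g i) φ s)
    (fun n => contDiff_stepPiece (hψ n) hg hφ)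
    (fun n => stepPiece_nonneg (hψ_nonneg n) g.nonneg hφ_nonneg)
    (fun n => locallyFinite_support_stepPiece (hψ_zero n) g.locallyFinite)
    (exists_stepPiece_ne_zero
      (fun v hv => (hψ_one v hv).mono fun n hn => by simp [hn.eq_of_nhds])
      (fun v => (g.exists_pos (mem_univ v)).imp fun _ hi => hi.ne')
      (hφ.continuous.continuousAt.eventually_ne (by simp [hφ_one])))
  refine ⟨_, f, hf, fun p x hx => (hf_supp p).trans ?_⟩
  exact (support_stepPiece_subset_closedBall (by positivity) hg_ball hφ_ball (hf_supp p hx)).trans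
    (closedBall_subset_closedBall (by linarith))

theorem corollary5 (k : ℕ∞) (hk : 1 ≤ k) (Ω : Ordinal.{u})
    (E : Type v) [NormedAddCommGroup E] [NormedSpace ℝ E] [CompleteSpace E]
    (hE : AdmitsPartitionsOfUnity k E) :
    AdmitsPartitionsOfUnity k C(Set.Icc (0 : Ordinal.{u}) Ω, E) :=
  corollary5_general hE
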